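/- Let $S$ be a finite semigroup. Call $S$ semilattice indecomposable if every homomorphic image of $S$ that is a semilattice (a commutative semigroup of idempotents) has only one element, and call $S$ $B_2$-combinatorial if $S$ is semilattice indecomposable and there is an integer $k\ge 0$ such that $|S|=4k+1$ and $S$ has a subsemilattice (a subsemigroup that is a semilattice) with $2k+1$ elements. For $a\in S$ let $J(a)$ be the principal (two-sided) ideal of $S$ generated by $a$, let $I(a)=\{b\in J(a) : J(b)\neq J(a)\}$, which is empty or an ideal, and let $J(a)/I(a)$ be the corresponding principal factor, that is, the Rees factor semigroup obtained from $J(a)$ by identifying all elements of $I(a)$ with one another. Let $B_2=\mathcal M^0(1;2,2;I)$ be the Rees matrix semigroup with zero over the one-element group whose sandwich matrix is the $2\times 2$ identity matrix. Then the following two conditions are equivalent: (i) $S$ is $B_2$-combinatorial; (ii) $S$ has a zero and, for every nonzero element $a$ of $S$, the principal factor $J(a)/I(a)$ is isomorphic to $B_2$. -/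

import Mathlib

universe u v w

namespace SemigroupTheory

/-- A semigroup is a semilattice if it is commutative and each of its elements is idempotent. -/
def IsSemilattice (T : Type u) [Semigroup T] : Prop :=
  (∀ x y : T, x * y = y * x) ∧ ∀ x : T, x * x = x

/-- Semilattice indecomposability: each semilattice that is a homomorphic image of `S` is trivial.
(A homomorphic image of `S` has an isomorphic copy in the universe of `S`.) -/
def IsSIndecomposable (S : Type u) [Semigroup S] : Prop :=
  ∀ (T : Type u) [Semigroup T] (φ : S →ₙ* T),
    Function.Surjective φ → IsSemilattice T → Subsingleton T

/-- `S` is s-indecomposable, `|S| = 4k + 1`, and `S` has a subsemilattice of size `2k + 1`. -/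
def IsB2Combinatorial (S : Type u) [Semigroup S] : Prop :=
  IsSIndecomposable S ∧
    ∃ k : ℕ, Nat.card S = 4 * k + 1 ∧
      ∃ Y : Subsemigroup S, IsSemilattice Y ∧ Nat.card Y = 2 * k + 1

/-- `z` is a (two-sided) zero of the semigroup `S`. -/
def IsZeroElement {S : Type u} [Semigroup S] (z : S) : Prop :=
  ∀ x : S, z * x = z ∧ x * z = z

/-- The principal ideal `J(a) = S¹ a S¹`, as a subsemigroup of `S`. -/
def principalIdeal {S : Type u} [Semigroup S] (a : S) : Subsemigroup S where
  carrier := {x | ∃ s t : WithOne S, (x : WithOne S) = s * a * t}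
  mul_mem' := by
    rintro x y ⟨s, t, hx⟩ -
    exact ⟨s, t * y, by rw [WithOne.coe_mul, hx, mul_assoc]⟩

theorem self_mem_principalIdeal {S : Type u} [Semigroup S] (a : S) : a ∈ principalIdeal a :=
  ⟨1, 1, by simp⟩

theorem mul_left_mem_principalIdeal {S : Type u} [Semigroup S] {a x : S} (s : S)
    (hx : x ∈ principalIdeal a) : s * x ∈ principalIdeal a := by
  obtain ⟨p, q, h⟩ := hx
  exact ⟨s * p, q, by rw [WithOne.coe_mul, h]; simp only [mul_assoc]⟩

theorem mul_right_mem_principalIdeal {S : Type u} [Semigroup S] {a x : S} (s : S)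
    (hx : x ∈ principalIdeal a) : x * s ∈ principalIdeal a := by
  obtain ⟨p, q, h⟩ := hx
  exact ⟨p, q * s, by rw [WithOne.coe_mul, h]; simp only [mul_assoc]⟩

theorem principalIdeal_le {S : Type u} [Semigroup S] {a b : S} (h : b ∈ principalIdeal a) :
    principalIdeal b ≤ principalIdeal a := by
  rintro x ⟨s, t, hx⟩
  obtain ⟨p, q, hb⟩ := h
  exact ⟨s * p, q * t, by rw [hx, hb]; simp only [mul_assoc]⟩

/-- `I(a) = {b ∈ J(a) : J(b) ≠ J(a)}`, as a subset of `J(a)`. -/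
def principalRemainder {S : Type u} [Semigroup S] (a : S) : Set (principalIdeal a) :=
  {b | principalIdeal (b : S) ≠ principalIdeal a}

/-- Closure of a set under multiplication from both sides by arbitrary elements
(so the set is empty or a two-sided ideal). -/
def IsEmptyOrIdeal {T : Type u} [Semigroup T] (I : Set T) : Prop :=
  ∀ x ∈ I, ∀ s : T, s * x ∈ I ∧ x * s ∈ I

theorem isEmptyOrIdeal_principalRemainder {S : Type u} [Semigroup S] (a : S) :
    IsEmptyOrIdeal (principalRemainder a) := by
  intro x hx s
  have key : ∀ y : principalIdeal a, principalIdeal (y : S) ≤ principalIdeal (x : S) →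
      y ∈ principalRemainder a := by
    intro y hy (h : principalIdeal (y : S) = principalIdeal a)
    exact hx (le_antisymm (principalIdeal_le x.2) (h.symm.le.trans hy))
  exact ⟨key _ (principalIdeal_le
      (mul_left_mem_principalIdeal (s : S) (self_mem_principalIdeal (x : S)))),
    key _ (principalIdeal_le
      (mul_right_mem_principalIdeal (s : S) (self_mem_principalIdeal (x : S))))⟩

/-- The Rees congruence of `I`: it identifies all elements of `I` with each other and nothing
else. For `I = ∅` it is equality. -/
def reesCon {T : Type u} [Semigroup T] (I : Set T) (hI : IsEmptyOrIdeal I) : Con T where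
  r x y := x = y ∨ (x ∈ I ∧ y ∈ I)
  iseqv :=
    { refl := fun _ => Or.inl rfl
      symm := by
        rintro x y (rfl | ⟨hx, hy⟩)
        · exact Or.inl rfl
        · exact Or.inr ⟨hy, hx⟩
      trans := by
        rintro x y z (rfl | ⟨hx, hy⟩) (rfl | ⟨hy', hz⟩)
        · exact Or.inl rfl
        · exact Or.inr ⟨hy', hz⟩
        · exact Or.inr ⟨hx, hy⟩
        · exact Or.inr ⟨hx, hz⟩ }
  mul' := by
    rintro w x y z (rfl | ⟨hw, hx⟩) (rfl | ⟨hy, hz⟩)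
    · exact Or.inl rfl
    · exact Or.inr ⟨(hI _ hy _).1, (hI _ hz _).1⟩
    · exact Or.inr ⟨(hI _ hw _).2, (hI _ hx _).2⟩
    · exact Or.inr ⟨(hI _ hw _).2, (hI _ hx _).2⟩

/-- The principal factor `J(a)/I(a)`, a Rees factor semigroup. -/
abbrev PrincipalFactor {S : Type u} [Semigroup S] (a : S) : Type u :=
  (reesCon (principalRemainder a) (isEmptyOrIdeal_principalRemainder a)).Quotient

/-- The carrier of the Rees matrix semigroup `M⁰(G; I, Λ; P)` over the group with zero `G⁰`:
a zero and the triples `(g; i, l)` with `g ∈ G`, `i ∈ I`, `l ∈ Λ`. -/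
inductive ReesMatrix {G : Type u} {I : Type v} {Λ : Type w}
    (P : Matrix Λ I (WithZero G)) : Type (max u v w) where
  | zero : ReesMatrix P
  | triple (g : G) (i : I) (l : Λ) : ReesMatrix P

namespace ReesMatrix

variable {G : Type u} [Group G] {I : Type v} {Λ : Type w} {P : Matrix Λ I (WithZero G)}

/-- `(x; i, l)` for `x ∈ G⁰`, where every `(0; i, l)` is the zero. -/
def ofEntry (P : Matrix Λ I (WithZero G)) (x : WithZero G) (i : I) (l : Λ) : ReesMatrix P :=
  WithZero.recZeroCoe (motive := fun _ => ReesMatrix P) zero (fun g => triple g i l) x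

/-- `(g; i, l) (h; j, m) = (g p_{l j} h; i, m)`. -/
protected def mul : ReesMatrix P → ReesMatrix P → ReesMatrix P
  | triple g i l, triple h j m => ofEntry P ((g : WithZero G) * P l j * (h : WithZero G)) i m
  | zero, _ => zero
  | triple _ _ _, zero => zero

instance instSemigroup : Semigroup (ReesMatrix P) where
  mul := ReesMatrix.mul
  mul_assoc := by
    have h0 : ∀ i l, ofEntry P 0 i l = zero := fun _ _ => rfl
    have h1 : ∀ (g : G) i l, ofEntry P (g : WithZero G) i l = triple g i l := fun _ _ _ => rfl
    have hl : ∀ (x : WithZero G) i l h j m, ReesMatrix.mul (ofEntry P x i l) (triple h j m) =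
        ofEntry P (x * P l j * (h : WithZero G)) i m := by
      intro x i l h j m
      induction x with
      | zero => simp only [zero_mul, h0]; rfl
      | coe g => rfl
    have hr : ∀ (x : WithZero G) g i l j m, ReesMatrix.mul (triple g i l) (ofEntry P x j m) =
        ofEntry P ((g : WithZero G) * P l j * x) i m := by
      intro x g i l j m
      induction x with
      | zero => simp only [mul_zero, h0]; rfl
      | coe g => rfl
    have hz : ∀ x : ReesMatrix P, ReesMatrix.mul x zero = zero := by
      rintro (_ | ⟨g, i, l⟩) <;> rfl
    intro x y z
    change ReesMatrix.mul (ReesMatrix.mul x y) z = ReesMatrix.mul x (ReesMatrix.mul y z)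
    rcases x with _ | ⟨g, i, l⟩
    · rfl
    rcases y with _ | ⟨h, j, m⟩
    · rfl
    rcases z with _ | ⟨k, n, o⟩
    · simp only [hz]
    · change ReesMatrix.mul (ofEntry P _ i m) _ = ReesMatrix.mul _ (ofEntry P _ j o)
      rw [hl, hr]
      simp only [mul_assoc]

end ReesMatrix

/-- The five-element Brandt semigroup `B₂ = M⁰(1; 2, 2; I)`: the group is trivial and the
sandwich matrix is the `2 × 2` identity matrix. -/
abbrev B2 : Type := ReesMatrix (1 : Matrix (Fin 2) (Fin 2) (WithZero Unit))

end SemigroupTheory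

/-!
The comparison runs over the `J`-classes of `S`, that is, the fibres of `x ↦ J(x)`.

Let `Y` be a subsemilattice of a semilattice indecomposable `S`, and let a `J`-class have `c`
elements, `n` of them in `Y`. Distinct idempotents of `Y` in one class have their product strictly
below the class (`eq_of_commute_of_mem`), and it follows that `n ^ 2 ≤ c` (`ncard_mul_self_le`).
If the class has an idempotent and at most two elements, enough of its products stay in the class
for the elements above it to form a subsemigroup whose complement is an ideal; this
gives a homomorphism to the two-element semilattice, so the class must be the least one
(`mem_principalIdeal_of_class_subset_pair`). Hence `2 * n ≤ c` for each class but the least, with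
equality only for `n = 2`, `c = 4`. The least class has `n ≤ 1 ≤ c`. Summing up,
`2 * |Y| ≤ |S| + 1`, and a `B₂`-combinatorial semigroup is an extremal case: its least class is a
zero and each other class has four elements, two of which are orthogonal idempotents
(`exists_zero_of_card_add_one_eq`). Such a class is a system of `2 × 2` matrix units
(`exists_isMatrixUnits`), which is what a principal factor `B₂` amounts to.

Conversely, let each nonzero class be a system of `2 × 2` matrix units. Each element of `S` then has
a unique inverse, so the idempotents commute and form a subsemilattice, with two elements in each
nonzero class of four (`isB2Combinatorial_of_matrixUnits`). A homomorphism to a semilattice is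
constant on `J`-classes, and its value on a nonzero class is also taken strictly below that class, at
the product of the two idempotents; by descent it is constant
(`isSIndecomposable_of_matrixUnits`).
-/

namespace SemigroupTheory

/-! ### Principal ideals -/

section PrincipalIdeals

variable {S : Type*} [Semigroup S]

theorem mem_principalIdeal_iff {a x : S} : x ∈ principalIdeal a ↔
    x = a ∨ (∃ s, x = s * a) ∨ (∃ t, x = a * t) ∨ ∃ s t, x = s * a * t := by
  constructor
  · rintro ⟨s, t, h⟩
    cases s <;> cases t
    · exact .inl (WithOne.coe_injective (by simpa using h))
    · rename_i t
      exact .inr (.inr (.inl ⟨t, WithOne.coe_injective (by simpa using h)⟩))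
    · rename_i s
      exact .inr (.inl ⟨s, WithOne.coe_injective (by simpa using h)⟩)
    · rename_i s t
      exact .inr (.inr (.inr ⟨s, t, WithOne.coe_injective (by simpa using h)⟩))
  · have ha := self_mem_principalIdeal a
    rintro (rfl | ⟨s, rfl⟩ | ⟨t, rfl⟩ | ⟨s, t, rfl⟩)
    · exact ha
    · exact mul_left_mem_principalIdeal s ha
    · exact mul_right_mem_principalIdeal t ha
    · exact mul_right_mem_principalIdeal t (mul_left_mem_principalIdeal s ha)

theorem principalIdeal_eq_iff {x y : S} :
    principalIdeal x = principalIdeal y ↔ x ∈ principalIdeal y ∧ y ∈ principalIdeal x :=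
  ⟨fun h => ⟨h ▸ self_mem_principalIdeal x, h ▸ self_mem_principalIdeal y⟩,
    fun h => le_antisymm (principalIdeal_le h.1) (principalIdeal_le h.2)⟩

theorem principalIdeal_mul_le_left (x y : S) : principalIdeal (x * y) ≤ principalIdeal x :=
  principalIdeal_le (mul_right_mem_principalIdeal y (self_mem_principalIdeal x))

theorem principalIdeal_mul_le_right (x y : S) : principalIdeal (x * y) ≤ principalIdeal y :=
  principalIdeal_le (mul_left_mem_principalIdeal x (self_mem_principalIdeal y))

/-- An idempotent in `J(x)` is a two-sided multiple of `x` inside `S` itself, the multipliers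
being absorbed by the idempotent: no identity has to be adjoined. -/
theorem exists_eq_mul_mul_of_mem {e x : S} (he : e * e = e) (h : e ∈ principalIdeal x) :
    ∃ p q, e = p * x * q ∧ e * p = p ∧ q * e = q := by
  rcases mem_principalIdeal_iff.1 h with h | ⟨s, h⟩ | ⟨t, h⟩ | ⟨s, t, h⟩
  · exact ⟨e, e, by rw [← h, he, he], he, he⟩
  · refine ⟨e * s, e, ?_, by rw [← mul_assoc, he], he⟩
    rw [mul_assoc e, ← h, he, he]
  · refine ⟨e, t * e, ?_, he, by rw [mul_assoc, he]⟩
    rw [mul_assoc, ← mul_assoc x, ← h, he, he]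
  · refine ⟨e * s, t * e, ?_, by rw [← mul_assoc, he], by rw [mul_assoc, he]⟩
    rw [← mul_assoc, mul_assoc e, mul_assoc e, ← h, he, he]

theorem IsZeroElement.eq_of_mem {z x : S} (hz : IsZeroElement z) (h : x ∈ principalIdeal z) :
    x = z := by
  rcases mem_principalIdeal_iff.1 h with h | ⟨s, h⟩ | ⟨t, h⟩ | ⟨s, t, h⟩
  · exact h
  · rw [h, (hz s).2]
  · rw [h, (hz t).1]
  · rw [h, (hz s).2, (hz t).1]

theorem IsZeroElement.principalIdeal_eq_iff {z x : S} (hz : IsZeroElement z) :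
    principalIdeal x = principalIdeal z ↔ x = z :=
  ⟨fun h => hz.eq_of_mem (h ▸ self_mem_principalIdeal x), fun h => h ▸ rfl⟩

end PrincipalIdeals

/-! ### Idempotents in a finite `J`-class -/

section Stability

variable {S : Type*} [Semigroup S] [Finite S]

/-- In a finite semigroup, an idempotent strictly below the idempotent `e` in the natural order
generates a strictly smaller principal ideal. -/
theorem eq_of_idempotent_le {e g : S} (he : e * e = e) (heg : e * g = g) (hge : g * e = g)
    (hg : g * g = g) (h : e ∈ principalIdeal g) : g = e := by
  obtain ⟨p, q, hpq, -, -⟩ := exists_eq_mul_mul_of_mem he h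
  -- Left multiplication by `g * q * e` has the left inverse `p * _` on `eS`, so it is onto `eS`;
  -- its image lies in `gS`.
  have hinj : Function.Injective
      (fun s : {s : S // e * s = s} => (⟨g * q * e * s, by
        simp only [← mul_assoc, heg]⟩ : {s : S // e * s = s})) := by
    rintro ⟨s, hs⟩ ⟨t, ht⟩ hst
    have hst : g * q * e * s = g * q * e * t := congrArg Subtype.val hst
    have key : ∀ r, e * r = r → p * (g * q * e * r) = r := by
      intro r hr
      rw [← mul_assoc, ← mul_assoc, ← mul_assoc, ← hpq, he, hr]
    exact Subtype.ext ((key s hs).symm.trans (hst ▸ key t ht))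
  obtain ⟨⟨s, _⟩, h⟩ := Finite.surjective_of_injective hinj ⟨e, he⟩
  have h : g * q * e * s = e := congrArg Subtype.val h
  calc g = g * e := hge.symm
    _ = g * (g * q * e * s) := by rw [h]
    _ = g * q * e * s := by simp only [← mul_assoc, hg]
    _ = e := h

/-- Distinct commuting idempotents of one `J`-class are orthogonal in the principal factor. -/
theorem eq_of_commute_of_mem {e f : S} (he : e * e = e) (hf : f * f = f) (hc : e * f = f * e)
    (h₁ : e ∈ principalIdeal (e * f)) (h₂ : f ∈ principalIdeal (e * f)) : e = f := by
  have hi : e * f * (e * f) = e * f := by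
    rw [mul_assoc, ← mul_assoc f, ← hc, mul_assoc e f f, hf, ← mul_assoc, he]
  rw [← eq_of_idempotent_le he (by rw [← mul_assoc, he]) (by rw [hc, mul_assoc, he]) hi h₁]
  exact eq_of_idempotent_le hf (by rw [hc, ← mul_assoc, hf]) (by rw [mul_assoc, hf]) hi h₂

end Stability

/-! ### Semilattice indecomposability -/

section Indecomposable

variable {S : Type*} [Semigroup S]

/-- If `J(e)`, for an idempotent `e`, is such that the elements of its `J`-class in `eS` and in
`Se` multiply within it, then the elements `x` with `e ∈ J(x)` form a subsemigroup whose
complement is an ideal, that is, a homomorphism to the two-element semilattice. In a semilattice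
indecomposable semigroup the complement is then empty. -/
theorem mem_principalIdeal_of_closed (hS : IsSIndecomposable S) {e : S} (he : e * e = e)
    (hcl : ∀ r l, e ∈ principalIdeal r → e ∈ principalIdeal l → e * r = r → l * e = l →
      e ∈ principalIdeal (r * l)) (x : S) : e ∈ principalIdeal x := by
  have hmul : ∀ x y, e ∈ principalIdeal (x * y) ↔ e ∈ principalIdeal x ∧ e ∈ principalIdeal y := by
    refine fun x y => ⟨fun h => ⟨principalIdeal_mul_le_left x y h,
      principalIdeal_mul_le_right x y h⟩, fun ⟨hx, hy⟩ => ?_⟩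
    obtain ⟨p, q, hpq, hp, -⟩ := exists_eq_mul_mul_of_mem he hx
    obtain ⟨p', q', hpq', -, hq'⟩ := exists_eq_mul_mul_of_mem he hy
    have h := hcl (p * x) (y * q') (mem_principalIdeal_iff.2 (.inr (.inr (.inl ⟨q, hpq⟩))))
      (mem_principalIdeal_iff.2 (.inr (.inl ⟨p', by rw [← mul_assoc, ← hpq']⟩)))
      (by rw [← mul_assoc, hp]) (by rw [mul_assoc, hq'])
    refine principalIdeal_le ?_ h
    exact mem_principalIdeal_iff.2 (.inr (.inr (.inr ⟨p, q', by simp only [mul_assoc]⟩)))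
  let c : Con S :=
    { r := fun x y => e ∈ principalIdeal x ↔ e ∈ principalIdeal y
      iseqv := ⟨fun _ => Iff.rfl, Iff.symm, Iff.trans⟩
      mul' := by
        intro w x y z h₁ h₂
        rw [hmul, hmul, h₁, h₂] }
  have hsub : Subsingleton c.Quotient := by
    refine hS c.Quotient ⟨fun x => (x : c.Quotient), fun _ _ => rfl⟩ Quotient.mk_surjective ⟨?_, ?_⟩
    · intro x y
      induction x, y using Con.induction_on₂ with
      | _ x y => exact (Con.eq c).2 (show _ ↔ _ by rw [hmul, hmul, and_comm])
    · intro x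
      induction x using Con.induction_on with
      | _ x => exact (Con.eq c).2 (show _ ↔ _ by rw [hmul, and_self])
  have h : c e x := (Con.eq c).1 (Subsingleton.elim (e : c.Quotient) (x : c.Quotient))
  exact h.1 (self_mem_principalIdeal e)

/-- In a semilattice indecomposable semigroup, a `J`-class with an idempotent and at most two
elements is the least one. -/
theorem mem_principalIdeal_of_class_subset_pair (hS : IsSIndecomposable S) {e a : S}
    (he : e * e = e) (hJ : ∀ x, principalIdeal x = principalIdeal e → x = e ∨ x = a) (x : S) :
    e ∈ principalIdeal x := by
  refine mem_principalIdeal_of_closed hS he (fun r l hr hl her hle => ?_) x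
  have hJ' : ∀ x, x ∈ principalIdeal e → e ∈ principalIdeal x → x = e ∨ x = a :=
    fun x h₁ h₂ => hJ x (principalIdeal_eq_iff.2 ⟨h₁, h₂⟩)
  have hme := self_mem_principalIdeal e
  have hr' : r = e ∨ r = a := hJ' r (her ▸ mul_right_mem_principalIdeal r hme) hr
  have hl' : l = e ∨ l = a := hJ' l (hle ▸ mul_left_mem_principalIdeal l hme) hl
  rcases eq_or_ne e a with hea | hea
  · have hr : r = e := by grind
    have hl : l = e := by grind
    rw [hr, hl, he]
    exact hme
  rcases eq_or_ne (a * a) e with haa | haa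
  · have hae : a * e = e * a := by rw [← haa, mul_assoc]
    have : r * l = e ∨ r * l = r ∨ r * l = l := by grind
    rcases this with h | h | h
    exacts [h.symm ▸ hme, h.symm ▸ hr, h.symm ▸ hl]
  by_cases ha : e ∈ principalIdeal a
  swap
  · have hr : r = e := by grind
    have hl : l = e := by grind
    rw [hr, hl, he]
    exact hme
  obtain ⟨p, q, hpq, hp, hq⟩ := exists_eq_mul_mul_of_mem he ha
  -- A multiplier `p` with `p * a = e` lies in the class and, as `a * a ≠ e`, it can only be `e`.
  have hpa : p * a = e → e * a = e := by
    intro h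
    rcases hJ' p (hp ▸ mul_right_mem_principalIdeal p hme)
      (mem_principalIdeal_iff.2 (.inr (.inr (.inl ⟨a, h.symm⟩)))) with rfl | rfl
    exacts [h, absurd h haa]
  have haq : a * q = e → a * e = e := by
    intro h
    rcases hJ' q (hq ▸ mul_left_mem_principalIdeal q hme)
      (mem_principalIdeal_iff.2 (.inr (.inl ⟨a, h.symm⟩))) with rfl | rfl
    exacts [h, absurd h haa]
  have h1 : a * e = a → e * a = e := by
    intro h
    rcases hJ' (a * q) (by
        rw [← h, mul_assoc]
        exact mem_principalIdeal_iff.2 (.inr (.inr (.inr ⟨a, q, by rw [mul_assoc]⟩))))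
      (mem_principalIdeal_iff.2 (.inr (.inl ⟨p, by rw [← mul_assoc, ← hpq]⟩))) with h' | h'
    · exact absurd (h.symm.trans (haq h')).symm hea
    · exact hpa (by rw [hpq, mul_assoc, h'])
  have h2 : e * a = a → a * e = e := by
    intro h
    rcases hJ' (p * a) (by
        rw [← h, ← mul_assoc]
        exact mem_principalIdeal_iff.2 (.inr (.inr (.inr ⟨p, a, rfl⟩))))
      (mem_principalIdeal_iff.2 (.inr (.inr (.inl ⟨q, hpq⟩)))) with h' | h'
    · exact absurd (h.symm.trans (hpa h')).symm hea
    · exact haq (by rw [← h', ← hpq])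
  have : r * l = e := by
    rcases hr' with rfl | rfl <;> rcases hl' with rfl | rfl
    · exact he
    · exact h1 hle
    · exact h2 her
    · exact absurd ((h2 her).symm.trans hle) hea
  rw [this]
  exact hme

end Indecomposable

/-! ### Counting along `J`-classes -/

/-- The cardinality of each subset is the sum over the fibres of `f`, all sums being over the same
finite range. -/
theorem exists_range_ncard_eq_sum {α β : Type*} [Finite α] (f : α → β) :
    ∃ T : Finset β, (∀ b, b ∈ T ↔ ∃ x, f x = b) ∧
      ∀ s : Set α, s.ncard = ∑ b ∈ T, {x | f x = b ∧ x ∈ s}.ncard := by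
  classical
  have := Fintype.ofFinite α
  refine ⟨Finset.univ.image f, by simp, fun s => ?_⟩
  rw [Set.ncard_eq_toFinset_card' s, Finset.card_eq_sum_card_fiberwise (f := f)
    (t := Finset.univ.image f) (by intro x _; simp)]
  refine Finset.sum_congr rfl fun b _ => ?_
  rw [Set.ncard_eq_toFinset_card']
  congr 1
  ext x
  simp [and_comm]

section Bound

variable {S : Type*} [Semigroup S] [Finite S]

/-- If a `J`-class meets a set of commuting idempotents in `n` elements, then it has at least
`n ^ 2` elements: pairwise orthogonality makes the sets `eSf` disjoint within the class, and none
of them is empty there. -/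
theorem ncard_mul_self_le {Y : Set S} (hc : ∀ x ∈ Y, ∀ y ∈ Y, x * y = y * x)
    (hi : ∀ x ∈ Y, x * x = x) (a : S) :
    {x | principalIdeal x = principalIdeal a ∧ x ∈ Y}.ncard *
      {x | principalIdeal x = principalIdeal a ∧ x ∈ Y}.ncard ≤
      {x | principalIdeal x = principalIdeal a}.ncard := by
  set E := {x | principalIdeal x = principalIdeal a ∧ x ∈ Y} with hE
  have hex : ∀ p : S × S, ∃ x, p ∈ E ×ˢ E →
      principalIdeal x = principalIdeal a ∧ p.1 * x = x ∧ x * p.2 = x := by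
    rintro ⟨e, f⟩
    by_cases h : (e, f) ∈ E ×ˢ E
    · obtain ⟨⟨he, heY⟩, hf, hfY⟩ := h
      obtain ⟨p, q, hpq, hp, -⟩ := exists_eq_mul_mul_of_mem (x := f) (hi e heY)
        (principalIdeal_eq_iff.1 (he.trans hf.symm)).1
      refine ⟨p * f, fun _ => ⟨?_, by rw [← mul_assoc, hp], by rw [mul_assoc, hi f hfY]⟩⟩
      refine le_antisymm (hf ▸ principalIdeal_mul_le_right p f) ?_
      rw [← he]
      exact principalIdeal_le (mem_principalIdeal_iff.2 (.inr (.inr (.inl ⟨q, hpq⟩))))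
    · exact ⟨e, fun h' => absurd h' h⟩
  choose g hg using hex
  rw [← Set.ncard_prod]
  refine Set.ncard_le_ncard_of_injOn g (fun p hp => (hg p hp).1) ?_ (Set.toFinite _)
  rintro ⟨e, f⟩ h ⟨e', f'⟩ h' heq
  obtain ⟨hx, hex, hxf⟩ := hg _ h
  obtain ⟨-, hex', hxf'⟩ := hg _ h'
  rw [← heq] at hex' hxf'
  set x := g (e, f)
  obtain ⟨⟨he, heY⟩, hf, hfY⟩ := h
  obtain ⟨⟨he', heY'⟩, hf', hfY'⟩ := h'
  simp only at *
  have key : ∀ u ∈ Y, ∀ v ∈ Y, principalIdeal u = principalIdeal a →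
      principalIdeal v = principalIdeal a → principalIdeal x ≤ principalIdeal (u * v) → u = v := by
    intro u hu v hv hua hva h
    exact eq_of_commute_of_mem (hi u hu) (hi v hv) (hc u hu v hv)
      (h (by rw [hx, ← hua]; exact self_mem_principalIdeal u))
      (h (by rw [hx, ← hva]; exact self_mem_principalIdeal v))
  refine Prod.ext (key e heY e' heY' he he' ?_) (key f hfY f' hfY' hf hf' ?_)
  · have : e * e' * x = x := by rw [mul_assoc, hex', hex]
    calc principalIdeal x = principalIdeal (e * e' * x) := by rw [this]
      _ ≤ _ := principalIdeal_mul_le_left _ _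
  · have : x * (f * f') = x := by rw [← mul_assoc, hxf, hxf']
    calc principalIdeal x = principalIdeal (x * (f * f')) := by rw [this]
      _ ≤ _ := principalIdeal_mul_le_right _ _

/-- A finite nonempty semigroup has a least `J`-class. -/
theorem exists_forall_mem_principalIdeal [Nonempty S] :
    ∃ z : S, ∀ x, z ∈ principalIdeal x := by
  obtain ⟨_, ⟨z, rfl⟩, hz⟩ := (wellFounded_lt (α := Subsemigroup S)).has_min
    (Set.range principalIdeal) (Set.range_nonempty _)
  refine ⟨z, fun x => ?_⟩
  have h := (principalIdeal_mul_le_left z x).lt_or_eq.resolve_left (hz _ ⟨_, rfl⟩)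
  exact principalIdeal_mul_le_right z x (h ▸ self_mem_principalIdeal z)

/-- A `J`-class other than the least one that contains an idempotent has at least three elements.
For a class with one element in the subsemilattice, this replaces the quadratic bound
`ncard_mul_self_le`, which is too weak there. -/
theorem three_le_ncard_of_idempotent (hS : IsSIndecomposable S) {e : S} (he : e * e = e)
    (hmin : ∃ x, e ∉ principalIdeal x) :
    3 ≤ {x | principalIdeal x = principalIdeal e}.ncard := by
  by_contra! hlt
  obtain ⟨b, hb⟩ : ∃ b, ∀ x, principalIdeal x = principalIdeal e → x = e ∨ x = b := by
    by_contra! h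
    obtain ⟨b, hb, hbe, -⟩ := h e
    obtain ⟨c, hc, hce, hcb⟩ := h b
    have : 2 < {x | principalIdeal x = principalIdeal e}.ncard :=
      (Set.two_lt_ncard_iff (Set.toFinite _)).2
        ⟨e, b, c, rfl, hb, hc, hbe.symm, hce.symm, hcb.symm⟩
    omega
  obtain ⟨x, hx⟩ := hmin
  exact hx (mem_principalIdeal_of_class_subset_pair hS he hb x)

/-- The extremal case of the bound `2 * |Y| ≤ |S| + 1` on the size of a subsemilattice `Y`: the
least `J`-class is a zero and each other one has four elements, two of which lie in `Y`. -/
theorem exists_zero_of_card_add_one_eq (hS : IsSIndecomposable S) {Y : Set S}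
    (hc : ∀ x ∈ Y, ∀ y ∈ Y, x * y = y * x) (hi : ∀ x ∈ Y, x * x = x)
    (hcard : Nat.card S + 1 = 2 * Y.ncard) :
    ∃ z : S, IsZeroElement z ∧ ∀ a, a ≠ z →
      {x | principalIdeal x = principalIdeal a}.ncard = 4 ∧
      {x | principalIdeal x = principalIdeal a ∧ x ∈ Y}.ncard = 2 := by
  classical
  have : Nonempty S := by
    by_contra h
    rw [not_nonempty_iff] at h
    rw [Nat.card_of_isEmpty, Y.eq_empty_of_isEmpty, Set.ncard_empty] at hcard
    omega
  obtain ⟨z, hz⟩ := exists_forall_mem_principalIdeal (S := S)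
  obtain ⟨T, hT, hsum⟩ := exists_range_ncard_eq_sum (principalIdeal (S := S))
  set c : Subsemigroup S → ℕ := fun P => {x | principalIdeal x = P}.ncard with hcdef
  set n : Subsemigroup S → ℕ := fun P => {x | principalIdeal x = P ∧ x ∈ Y}.ncard with hndef
  have hS' : Nat.card S = ∑ P ∈ T, c P := by
    rw [← Set.ncard_univ, hsum]
    simp [hcdef]
  have hY' : Y.ncard = ∑ P ∈ T, n P := hsum Y
  have hzT : principalIdeal z ∈ T := (hT _).2 ⟨z, rfl⟩
  have hcpos : ∀ a, 1 ≤ c (principalIdeal a) := fun a =>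
    (Set.ncard_pos (Set.toFinite _)).2 ⟨a, rfl⟩
  have hnz : n (principalIdeal z) ≤ 1 := by
    refine (Set.ncard_le_one_iff (Set.toFinite _)).2 fun {e f} he hf => ?_
    exact eq_of_commute_of_mem (hi e he.2) (hi f hf.2) (hc e he.2 f hf.2)
      (principalIdeal_le (hz _) (he.1 ▸ self_mem_principalIdeal e))
      (principalIdeal_le (hz _) (hf.1 ▸ self_mem_principalIdeal f))
  have hbound : ∀ a, principalIdeal a ≠ principalIdeal z →
      n (principalIdeal a) = 0 ∨ 3 ≤ c (principalIdeal a) ∧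
        n (principalIdeal a) * n (principalIdeal a) ≤ c (principalIdeal a) := by
    intro a ha
    rcases Nat.eq_zero_or_pos (n (principalIdeal a)) with h | h
    · exact .inl h
    obtain ⟨e, hea, heY⟩ := (Set.ncard_pos (Set.toFinite _)).1 h
    refine .inr ⟨?_, ncard_mul_self_le hc hi a⟩
    have := three_le_ncard_of_idempotent hS (hi e heY)
      ⟨z, fun h => ha (hea ▸ principalIdeal_eq_iff.2 ⟨h, hz e⟩)⟩
    rwa [hea] at this
  have hle : ∀ P ∈ T.erase (principalIdeal z), 2 * n P ≤ c P := by
    intro P hP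
    obtain ⟨hP, hPT⟩ := Finset.mem_erase.1 hP
    obtain ⟨a, rfl⟩ := (hT P).1 hPT
    rcases hbound a hP with h | ⟨h1, h2⟩
    · omega
    · rcases Nat.lt_or_ge (n (principalIdeal a)) 2 with h | h
      · omega
      · exact (Nat.mul_le_mul_right _ h).trans h2
  have hsum_le := Finset.sum_le_sum hle
  rw [hS', hY', ← Finset.add_sum_erase T c hzT, ← Finset.add_sum_erase T n hzT, mul_add,
    Finset.mul_sum] at hcard
  have hcz := hcpos z
  have hsum_eq := (Finset.sum_eq_sum_iff_of_le hle).1 (by omega)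
  have hcz1 : c (principalIdeal z) = 1 := by omega
  have hzero : ∀ x, principalIdeal x = principalIdeal z → x = z := fun x hx =>
    (Set.ncard_le_one_iff (Set.toFinite _)).1 hcz1.le hx rfl
  refine ⟨z, fun x => ⟨hzero _ ?_, hzero _ ?_⟩, fun a ha => ?_⟩
  · exact le_antisymm (principalIdeal_mul_le_left _ _) (principalIdeal_le (hz _))
  · exact le_antisymm (principalIdeal_mul_le_right _ _) (principalIdeal_le (hz _))
  · have haz : principalIdeal a ≠ principalIdeal z := fun h => ha (hzero a h)
    have h1 : 2 * n (principalIdeal a) = c (principalIdeal a) :=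
      hsum_eq _ (Finset.mem_erase.2 ⟨haz, (hT _).2 ⟨a, rfl⟩⟩)
    have h2 := hcpos a
    change c (principalIdeal a) = 4 ∧ n (principalIdeal a) = 2
    rcases hbound a haz with h | ⟨h3, h4⟩
    · omega
    · have : n (principalIdeal a) ≤ 2 := by
        by_contra! h
        have := Nat.mul_le_mul_right (n (principalIdeal a)) h
        omega
      omega

end Bound

/-! ### Matrix units -/

section MatrixUnits

theorem ncard_range_eq_four {α : Type*} {m : Fin 2 → Fin 2 → α}
    (hm : ∀ i j k l, m i j = m k l → i = k ∧ j = l) :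
    {x | ∃ i j, x = m i j}.ncard = 4 := by
  have : {x | ∃ i j, x = m i j} = (fun p : Fin 2 × Fin 2 => m p.1 p.2) '' Set.univ := by
    ext x
    simp [eq_comm]
  rw [this, Set.ncard_image_of_injective _ fun p q h => Prod.ext (hm _ _ _ _ h).1 (hm _ _ _ _ h).2,
    Set.ncard_univ]
  simp

variable {S : Type*} [Semigroup S]

/-- The `J`-class of `a` consists of the `2 × 2` matrix units `m i j`, where products that are
zero for matrix units are only required to leave the `J`-class. -/
structure IsMatrixUnits (a : S) (m : Fin 2 → Fin 2 → S) : Prop where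
  principalIdeal_eq : ∀ i j, principalIdeal (m i j) = principalIdeal a
  mul_same : ∀ i j k, m i j * m j k = m i k
  mul_ne : ∀ i j k l, j ≠ k → principalIdeal (m i j * m k l) ≠ principalIdeal a
  exists_eq : ∀ x, principalIdeal x = principalIdeal a → ∃ i j, x = m i j

theorem matrixUnits_injective {a : S} {m : Fin 2 → Fin 2 → S}
    (hm : ∀ i j, principalIdeal (m i j) = principalIdeal a)
    (hs : ∀ i j k, m i j * m j k = m i k)
    (hn : ∀ i j k l, j ≠ k → principalIdeal (m i j * m k l) ≠ principalIdeal a)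
    {i j k l : Fin 2} (h : m i j = m k l) : i = k ∧ j = l := by
  constructor
  · by_contra hik
    exact hn i i k l hik (by rw [← h, hs, hm])
  · by_contra hjl
    exact hn k l j j (Ne.symm hjl) (by rw [← h, hs, hm])

theorem IsMatrixUnits.eq_iff {a : S} {m : Fin 2 → Fin 2 → S} (hm : IsMatrixUnits a m)
    {i j k l : Fin 2} : m i j = m k l ↔ i = k ∧ j = l :=
  ⟨matrixUnits_injective hm.1 hm.2 hm.3, by rintro ⟨rfl, rfl⟩; rfl⟩

theorem IsMatrixUnits.ncard_class {a : S} {m : Fin 2 → Fin 2 → S} (hm : IsMatrixUnits a m) :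
    {x | principalIdeal x = principalIdeal a}.ncard = 4 := by
  rw [← ncard_range_eq_four fun i j k l => hm.eq_iff.1]
  congr 1
  ext x
  exact ⟨hm.exists_eq x, by rintro ⟨i, j, rfl⟩; exact hm.principalIdeal_eq i j⟩

theorem IsMatrixUnits.ncard_idempotents {a : S} {m : Fin 2 → Fin 2 → S} (hm : IsMatrixUnits a m) :
    {x | principalIdeal x = principalIdeal a ∧ x * x = x}.ncard = 2 := by
  have : {x | principalIdeal x = principalIdeal a ∧ x * x = x} = {m 0 0, m 1 1} := by
    ext x
    constructor
    · rintro ⟨hx, hxx⟩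
      obtain ⟨i, j, rfl⟩ := hm.exists_eq x hx
      have hij : j = i := by
        by_contra h
        exact hm.mul_ne i j i j h (hxx.symm ▸ hx)
      subst hij
      fin_cases j <;> simp
    · rintro (rfl | rfl) <;> exact ⟨hm.principalIdeal_eq _ _, hm.mul_same _ _ _⟩
  rw [this, Set.ncard_pair]
  intro h
  exact absurd (hm.eq_iff.1 h).1 (by decide)

/-- Two distinct commuting idempotents in a `J`-class with four elements extend to a system of
matrix units for that class. -/
theorem exists_isMatrixUnits [Finite S] {a e f : S} (he : e * e = e) (hf : f * f = f)
    (hc : e * f = f * e) (hef : e ≠ f) (hea : principalIdeal e = principalIdeal a)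
    (hfa : principalIdeal f = principalIdeal a)
    (hcard : {x | principalIdeal x = principalIdeal a}.ncard = 4) :
    ∃ m, IsMatrixUnits a m := by
  have hortho : ¬ principalIdeal a ≤ principalIdeal (e * f) := fun h =>
    hef (eq_of_commute_of_mem he hf hc (h (hea ▸ self_mem_principalIdeal e))
      (h (hfa ▸ self_mem_principalIdeal f)))
  obtain ⟨p, q, hpq, hp, hq⟩ := exists_eq_mul_mul_of_mem he
    (principalIdeal_eq_iff.1 (hea.trans hfa.symm)).1
  have hxy : p * f * (f * q) = e := by rw [mul_assoc, ← mul_assoc f, hf, ← mul_assoc, hpq]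
  have hex : e * (p * f) = p * f := by rw [← mul_assoc, hp]
  have hye : f * q * e = f * q := by rw [mul_assoc, hq]
  have hxf : p * f * f = p * f := by rw [mul_assoc, hf]
  have hfy : f * (f * q) = f * q := by rw [← mul_assoc, hf]
  generalize p * f = x at hxy hex hxf
  generalize f * q = y at hxy hye hfy
  have hea' : ∀ w, e ∈ principalIdeal w → w ∈ principalIdeal e →
      principalIdeal w = principalIdeal a := fun w h₁ h₂ =>
    hea ▸ principalIdeal_eq_iff.2 ⟨h₂, h₁⟩
  have hx : principalIdeal x = principalIdeal a :=
    hea' x (mem_principalIdeal_iff.2 (.inr (.inr (.inl ⟨y, hxy.symm⟩))))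
      (mem_principalIdeal_iff.2 (.inr (.inr (.inl ⟨x, hex.symm⟩))))
  have hy : principalIdeal y = principalIdeal a :=
    hea' y (mem_principalIdeal_iff.2 (.inr (.inl ⟨x, hxy.symm⟩)))
      (mem_principalIdeal_iff.2 (.inr (.inl ⟨y, hye.symm⟩)))
  -- `y * x` is an idempotent below `f` in the same `J`-class.
  have hyx : y * x = f := by
    refine eq_of_idempotent_le hf (by rw [← mul_assoc, hfy]) (by rw [mul_assoc, hxf]) ?_ ?_
    · rw [mul_assoc, ← mul_assoc x, hxy, hex]
    · refine (hfa.trans hea.symm).le.trans (principalIdeal_le ?_) (self_mem_principalIdeal f)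
      refine mem_principalIdeal_iff.2 (.inr (.inr (.inr ⟨x, y, ?_⟩)))
      rw [← mul_assoc, hxy, mul_assoc, hxy, he]
  clear hpq
  have hm : ∀ i j, principalIdeal ((![![e, x], ![y, f]] : Fin 2 → Fin 2 → S) i j) =
      principalIdeal a := by
    simp [Fin.forall_fin_two, *]
  have hs : ∀ i j k, (![![e, x], ![y, f]] : Fin 2 → Fin 2 → S) i j *
      (![![e, x], ![y, f]] : Fin 2 → Fin 2 → S) j k =
      (![![e, x], ![y, f]] : Fin 2 → Fin 2 → S) i k := by
    simp [Fin.forall_fin_two, *]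
  have hd : ∀ j k, j ≠ k → (![![e, x], ![y, f]] : Fin 2 → Fin 2 → S) j j *
      (![![e, x], ![y, f]] : Fin 2 → Fin 2 → S) k k = e * f := by
    simp [Fin.forall_fin_two, hc]
  generalize (![![e, x], ![y, f]] : Fin 2 → Fin 2 → S) = m at hm hs hd
  have hn : ∀ i j k l, j ≠ k → principalIdeal (m i j * m k l) ≠ principalIdeal a := by
    intro i j k l hjk h
    refine hortho ?_
    rw [← h, ← hs i j j, ← hs k k l, ← hd j k hjk]
    refine principalIdeal_le (mem_principalIdeal_iff.2 (.inr (.inr (.inr ⟨m i j, m k l, ?_⟩))))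
    simp only [mul_assoc]
  refine ⟨m, hm, hs, hn, fun w hw => ?_⟩
  have hset : {x | ∃ i j, x = m i j} = {x | principalIdeal x = principalIdeal a} := by
    refine Set.eq_of_subset_of_ncard_le (by rintro _ ⟨i, j, rfl⟩; exact hm i j) ?_
    rw [hcard, ncard_range_eq_four fun i j k l => matrixUnits_injective hm hs hn]
  exact hset.symm.subset hw

end MatrixUnits

/-! ### Principal factors isomorphic to `B₂` -/

section PrincipalFactors

theorem B2_triple_mul_triple (i j k l : Fin 2) :
    (ReesMatrix.triple () i j * ReesMatrix.triple () k l : B2) =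
      if j = k then ReesMatrix.triple () i l else ReesMatrix.zero := by
  change ReesMatrix.ofEntry _ _ i l = _
  rw [Matrix.one_apply]
  split_ifs <;> rfl

theorem B2_zero_mul (x : B2) : (ReesMatrix.zero : B2) * x = ReesMatrix.zero := by
  cases x <;> rfl

theorem B2_mul_zero (x : B2) : x * (ReesMatrix.zero : B2) = ReesMatrix.zero := by
  cases x <;> rfl

variable {S : Type*} [Semigroup S]

theorem principalFactor_coe_eq {a : S} {x y : principalIdeal a} :
    (x : PrincipalFactor a) = y ↔ x = y ∨ principalIdeal (x : S) ≠ principalIdeal a ∧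
      principalIdeal (y : S) ≠ principalIdeal a :=
  Con.eq _

/-- The zero of `S` lies outside the `J`-class of `a ≠ z`, so the Rees quotient does have a zero, to
which the zero of `B₂` is sent. -/
theorem IsMatrixUnits.nonempty_mulEquiv {z a : S} (hz : IsZeroElement z) (ha : a ≠ z)
    {m : Fin 2 → Fin 2 → S} (hm : IsMatrixUnits a m) : Nonempty (PrincipalFactor a ≃* B2) := by
  have hza : principalIdeal z ≠ principalIdeal a := fun h => ha (hz.principalIdeal_eq_iff.1 h.symm)
  have hmem : ∀ i j, m i j ∈ principalIdeal a := fun i j =>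
    (principalIdeal_eq_iff.1 (hm.principalIdeal_eq i j)).1
  have hzmem : z ∈ principalIdeal a :=
    mem_principalIdeal_iff.2 (.inr (.inl ⟨z, ((hz a).1).symm⟩))
  let ψ : B2 → PrincipalFactor a
    | .zero => ((⟨z, hzmem⟩ : principalIdeal a) : PrincipalFactor a)
    | .triple _ i j => ((⟨m i j, hmem i j⟩ : principalIdeal a) : PrincipalFactor a)
  have hψ : ∀ x y, ψ (x * y) = ψ x * ψ y := by
    rintro (_ | ⟨⟨⟩, i, j⟩) y
    · rw [B2_zero_mul]
      cases y <;> exact congrArg _ (Subtype.ext ((hz _).1).symm)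
    rcases y with _ | ⟨⟨⟩, k, l⟩
    · rw [B2_mul_zero]
      exact congrArg _ (Subtype.ext ((hz _).2).symm)
    · change ψ ((ReesMatrix.triple () i j * ReesMatrix.triple () k l : B2)) = _
      rw [B2_triple_mul_triple]
      split_ifs with h
      · subst h
        exact congrArg _ (Subtype.ext (hm.mul_same i j l).symm)
      · exact principalFactor_coe_eq.2 (.inr ⟨hza, hm.mul_ne i j k l h⟩)
  refine ⟨(MulEquiv.ofBijective (⟨ψ, hψ⟩ : B2 →ₙ* PrincipalFactor a) ⟨?_, ?_⟩).symm⟩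
  · rintro (_ | ⟨⟨⟩, i, j⟩) (_ | ⟨⟨⟩, k, l⟩) h
    · rfl
    · rcases principalFactor_coe_eq.1 h with h | h
      · exact absurd ((congrArg (principalIdeal ∘ Subtype.val) h).trans
          (hm.principalIdeal_eq k l)) hza
      · exact absurd (hm.principalIdeal_eq k l) h.2
    · rcases principalFactor_coe_eq.1 h with h | h
      · exact absurd ((congrArg (principalIdeal ∘ Subtype.val) h).symm.trans
          (hm.principalIdeal_eq i j)) hza
      · exact absurd (hm.principalIdeal_eq i j) h.1
    · rcases principalFactor_coe_eq.1 h with h | h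
      · obtain ⟨rfl, rfl⟩ := hm.eq_iff.1 (congrArg Subtype.val h)
        rfl
      · exact absurd (hm.principalIdeal_eq i j) h.1
  · intro x
    induction x using Con.induction_on with
    | _ x =>
      by_cases hx : principalIdeal (x : S) = principalIdeal a
      · obtain ⟨i, j, h⟩ := hm.exists_eq x hx
        exact ⟨.triple () i j, congrArg _ (Subtype.ext h.symm)⟩
      · exact ⟨.zero, principalFactor_coe_eq.2 (.inr ⟨hza, hx⟩)⟩

/-- Representatives of the nonzero elements of `B₂` in the `J`-class are matrix units. -/
theorem exists_isMatrixUnits_of_mulEquiv {z a : S} (hz : IsZeroElement z) (ha : a ≠ z)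
    (Ψ : PrincipalFactor a ≃* B2) : ∃ m, IsMatrixUnits a m := by
  have hza : principalIdeal z ≠ principalIdeal a := fun h => ha (hz.principalIdeal_eq_iff.1 h.symm)
  have hzmem : z ∈ principalIdeal a :=
    mem_principalIdeal_iff.2 (.inr (.inl ⟨z, ((hz a).1).symm⟩))
  have hΨz : Ψ ((⟨z, hzmem⟩ : principalIdeal a) : PrincipalFactor a) = .zero := by
    obtain ⟨w, hw⟩ := Ψ.surjective .zero
    induction w using Con.induction_on with
    | _ w =>
      have h : ((⟨z, hzmem⟩ : principalIdeal a) : PrincipalFactor a) =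
          ((⟨z, hzmem⟩ : principalIdeal a) : PrincipalFactor a) * (w : PrincipalFactor a) :=
        congrArg (Con.toQuotient (c := reesCon _ _)) (Subtype.ext ((hz _).1).symm)
      rw [h, map_mul, hw, B2_mul_zero]
  have hzero : ∀ x : principalIdeal a, Ψ (x : PrincipalFactor a) = .zero ↔
      principalIdeal (x : S) ≠ principalIdeal a := by
    intro x
    rw [← hΨz, Ψ.injective.eq_iff, principalFactor_coe_eq]
    constructor
    · rintro (rfl | h)
      exacts [hza, h.1]
    · exact fun h => .inr ⟨h, hza⟩
  have hex : ∀ i j, ∃ x : principalIdeal a, Ψ (x : PrincipalFactor a) = .triple () i j := by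
    intro i j
    obtain ⟨w, hw⟩ := Ψ.surjective (.triple () i j)
    induction w using Con.induction_on with
    | _ w => exact ⟨w, hw⟩
  choose m hm using hex
  have hJ : ∀ i j, principalIdeal (m i j : S) = principalIdeal a := by
    intro i j
    by_contra h
    have := (hzero _).2 h
    rw [hm] at this
    cases this
  have hinj : ∀ x y : principalIdeal a, principalIdeal (x : S) = principalIdeal a →
      Ψ (x : PrincipalFactor a) = Ψ (y : PrincipalFactor a) → x = y := by
    intro x y hx h
    exact (principalFactor_coe_eq.1 (Ψ.injective h)).resolve_right fun h => h.1 hx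
  have hmul : ∀ i j k l, Ψ ((m i j * m k l : principalIdeal a) : PrincipalFactor a) =
      if j = k then .triple () i l else .zero := by
    intro i j k l
    rw [Con.coe_mul, map_mul, hm, hm, B2_triple_mul_triple]
  refine ⟨fun i j => m i j, hJ, fun i j k => ?_, fun i j k l hjk => ?_, fun x hx => ?_⟩
  · refine congrArg Subtype.val (hinj (m i k) (m i j * m j k) (hJ i k) ?_).symm
    rw [hmul, hm, if_pos rfl]
  · exact (hzero (m i j * m k l)).1 (by rw [hmul, if_neg hjk])
  · have hxa : x ∈ principalIdeal a := (principalIdeal_eq_iff.1 hx).1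
    rcases h : Ψ ((⟨x, hxa⟩ : principalIdeal a) : PrincipalFactor a) with _ | ⟨⟨⟩, i, j⟩
    · exact absurd hx ((hzero _).1 h)
    · exact ⟨i, j, congrArg Subtype.val (hinj ⟨x, hxa⟩ (m i j) hx (h.trans (hm i j).symm))⟩

end PrincipalFactors

/-! ### Semigroups whose nonzero principal factors are `B₂` -/

section OfMatrixUnits

variable {S : Type*} [Semigroup S]

/-- A homomorphism to a semilattice is monotone for the order of principal ideals. -/
theorem IsSemilattice.map_mul_map_of_mem {T : Type*} [Semigroup T] (hT : IsSemilattice T)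
    (φ : S →ₙ* T) {x y : S} (h : x ∈ principalIdeal y) : φ x * φ y = φ x := by
  obtain ⟨hc, hi⟩ := hT
  rcases mem_principalIdeal_iff.1 h with rfl | ⟨s, rfl⟩ | ⟨t, rfl⟩ | ⟨s, t, rfl⟩
  · exact hi _
  · rw [map_mul, mul_assoc, hi]
  · rw [map_mul, hc (φ y), mul_assoc, hi]
  · rw [map_mul, map_mul, mul_assoc, hc (φ t), ← mul_assoc, mul_assoc (φ s), hi]

theorem IsSemilattice.map_eq_of_principalIdeal_eq {T : Type*} [Semigroup T]
    (hT : IsSemilattice T) (φ : S →ₙ* T) {x y : S} (h : principalIdeal x = principalIdeal y) :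
    φ x = φ y := by
  obtain ⟨h₁, h₂⟩ := principalIdeal_eq_iff.1 h
  rw [← hT.map_mul_map_of_mem φ h₁, hT.1, hT.map_mul_map_of_mem φ h₂]

/-- Each nonzero `J`-class contains two idempotents whose product lies strictly below, so a
homomorphism to a semilattice takes the same value on the class and somewhere strictly below it;
descending, it takes the value at zero everywhere. -/
theorem isSIndecomposable_of_matrixUnits [Finite S] {z : S}
    (hm : ∀ a, a ≠ z → ∃ m, IsMatrixUnits a m) : IsSIndecomposable S := by
  intro T _ φ hφ hT
  have key : ∀ P : Subsemigroup S, ∀ a, principalIdeal a = P → φ a = φ z := by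
    intro P
    induction P using WellFoundedLT.induction with
    | _ P ih =>
      rintro a rfl
      rcases eq_or_ne a z with rfl | ha
      · rfl
      obtain ⟨m, hm⟩ := hm a ha
      have h : ∀ i, φ (m i i) = φ a := fun i =>
        hT.map_eq_of_principalIdeal_eq φ (hm.principalIdeal_eq i i)
      have hlt : principalIdeal (m 0 0 * m 1 1) < principalIdeal a :=
        lt_of_le_of_ne (hm.principalIdeal_eq 0 0 ▸ principalIdeal_mul_le_left _ _)
          (hm.mul_ne 0 0 1 1 (by decide))
      rw [← ih _ hlt _ rfl, map_mul, h, h, hT.2]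
  refine ⟨fun x y => ?_⟩
  obtain ⟨a, rfl⟩ := hφ x
  obtain ⟨b, rfl⟩ := hφ y
  rw [key _ a rfl, key _ b rfl]

theorem exists_inverse_of_matrixUnits {z : S} (hz : IsZeroElement z)
    (hm : ∀ a, a ≠ z → ∃ m, IsMatrixUnits a m) (x : S) :
    ∃ y, x * y * x = x ∧ y * x * y = y := by
  rcases eq_or_ne x z with rfl | hx
  · exact ⟨x, by rw [(hz x).1, (hz x).1], by rw [(hz x).1, (hz x).1]⟩
  · obtain ⟨m, hm⟩ := hm x hx
    obtain ⟨i, j, h⟩ := hm.exists_eq x rfl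
    exact ⟨m j i, by rw [h, hm.mul_same, hm.mul_same], by rw [h, hm.mul_same, hm.mul_same]⟩

theorem inverse_unique_of_matrixUnits {z : S} (hz : IsZeroElement z)
    (hm : ∀ a, a ≠ z → ∃ m, IsMatrixUnits a m) {x y y' : S} (hy : x * y * x = x)
    (hy₁ : y * x * y = y) (hy' : x * y' * x = x) (hy₁' : y' * x * y' = y') : y = y' := by
  rcases eq_or_ne x z with rfl | hx
  · rw [← hy₁, ← hy₁', (hz y).2, (hz y).1, (hz y').2, (hz y').1]
  · obtain ⟨m, hm⟩ := hm x hx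
    obtain ⟨i, j, h⟩ := hm.exists_eq x rfl
    have key : ∀ w, x * w * x = x → w * x * w = w → w = m j i := by
      intro w h₁ h₂
      have hw : principalIdeal w = principalIdeal x := principalIdeal_eq_iff.2
        ⟨mem_principalIdeal_iff.2 (.inr (.inr (.inr ⟨w, w, h₂.symm⟩))),
          mem_principalIdeal_iff.2 (.inr (.inr (.inr ⟨x, x, h₁.symm⟩)))⟩
      obtain ⟨k, l, rfl⟩ := hm.exists_eq w hw
      have hjk : j = k := by
        by_contra hjk
        refine hm.mul_ne i j k l hjk (le_antisymm ?_ ?_)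
        · exact h ▸ principalIdeal_mul_le_left _ _
        · calc principalIdeal x = principalIdeal (x * m k l * x) := by rw [h₁]
            _ ≤ principalIdeal (x * m k l) := principalIdeal_mul_le_left _ _
            _ = _ := by rw [← h]
      have hli : l = i := by
        by_contra hli
        refine hm.mul_ne k l i j hli (le_antisymm ?_ ?_)
        · exact h ▸ principalIdeal_mul_le_right _ _
        · calc principalIdeal x = principalIdeal (x * (m k l * x)) := by rw [← mul_assoc, h₁]
            _ ≤ principalIdeal (m k l * x) := principalIdeal_mul_le_right _ _
            _ = _ := by rw [← h]
      rw [hjk, hli]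
    rw [key y hy hy₁, key y' hy' hy₁']

/-- Idempotents commute in a semigroup in which each element has a unique inverse. -/
theorem idempotents_commute (hex : ∀ x : S, ∃ y, x * y * x = x ∧ y * x * y = y)
    (huniq : ∀ x y y' : S, x * y * x = x → y * x * y = y → x * y' * x = x → y' * x * y' = y' →
      y = y') {e f : S} (he : e * e = e) (hf : f * f = f) : e * f = f * e := by
  have hidem : ∀ e f : S, e * e = e → f * f = f → e * f * (e * f) = e * f := by
    intro e f he hf
    obtain ⟨x, h₁, h₂⟩ := hex (e * f)
    -- `f * x * e` is an inverse of `e * f` too, so it is `x`, which makes `x` idempotent.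
    have hx : x = f * x * e := by
      refine huniq (e * f) _ _ h₁ h₂ ?_ ?_
      · calc e * f * (f * x * e) * (e * f) = e * (f * f) * x * (e * e) * f := by
              simp only [mul_assoc]
          _ = e * f := by rw [he, hf, mul_assoc _ e f, h₁]
      · calc f * x * e * (e * f) * (f * x * e) = f * (x * ((e * e) * (f * f)) * x) * e := by
              simp only [mul_assoc]
          _ = f * x * e := by rw [he, hf, h₂]
    have hxx : x * x = x := by
      calc x * x = f * x * e * (f * x * e) := by rw [← hx]
        _ = f * (x * (e * f) * x) * e := by simp only [mul_assoc]
        _ = x := by rw [h₂, ← hx]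
    have : e * f = x := huniq x _ _ h₂ h₁ (by rw [hxx, hxx]) (by rw [hxx, hxx])
    rw [this, hxx]
  have h₁ := hidem e f he hf
  have h₂ := hidem f e hf he
  refine huniq (e * f) _ _ (by rw [h₁, h₁]) (by rw [h₁, h₁]) ?_ ?_
  · calc e * f * (f * e) * (e * f) = e * (f * f) * (e * e) * f := by simp only [mul_assoc]
      _ = e * f := by rw [he, hf, mul_assoc _ e f, h₁]
  · calc f * e * (e * f) * (f * e) = f * (e * e) * (f * f) * e := by simp only [mul_assoc]
      _ = f * e := by rw [he, hf, mul_assoc _ f e, h₂]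

theorem isB2Combinatorial_of_matrixUnits [Finite S] {z : S} (hz : IsZeroElement z)
    (hm : ∀ a, a ≠ z → ∃ m, IsMatrixUnits a m) : IsB2Combinatorial S := by
  classical
  refine ⟨isSIndecomposable_of_matrixUnits hm, ?_⟩
  have hcomm : ∀ e f : S, e * e = e → f * f = f → e * f = f * e := fun e f he hf =>
    idempotents_commute (exists_inverse_of_matrixUnits hz hm)
      (fun _ _ _ h₁ h₂ h₃ h₄ => inverse_unique_of_matrixUnits hz hm h₁ h₂ h₃ h₄) he hf
  let E : Subsemigroup S :=
    { carrier := {x | x * x = x}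
      mul_mem' := by
        intro e f (he : e * e = e) (hf : f * f = f)
        change e * f * (e * f) = e * f
        rw [mul_assoc, ← mul_assoc f, ← hcomm e f he hf, mul_assoc e f f, hf, ← mul_assoc, he] }
  obtain ⟨T, hT, hsum⟩ := exists_range_ncard_eq_sum (principalIdeal (S := S))
  have hzT : principalIdeal z ∈ T := (hT _).2 ⟨z, rfl⟩
  have hclass : ∀ P ∈ T.erase (principalIdeal z), ∃ a m, principalIdeal a = P ∧
      IsMatrixUnits a m := by
    intro P hP
    obtain ⟨hP, hPT⟩ := Finset.mem_erase.1 hP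
    obtain ⟨a, rfl⟩ := (hT P).1 hPT
    obtain ⟨m, hm⟩ := hm a fun h => hP (h ▸ rfl)
    exact ⟨a, m, rfl, hm⟩
  refine ⟨(T.erase (principalIdeal z)).card, ?_, E, ⟨?_, ?_⟩, ?_⟩
  · rw [← Set.ncard_univ, hsum, ← Finset.add_sum_erase T _ hzT, Finset.sum_eq_card_nsmul (b := 4)]
    · have : {x | principalIdeal x = principalIdeal z ∧ x ∈ Set.univ} = {z} := by
        ext x
        simp [hz.principalIdeal_eq_iff]
      rw [this, Set.ncard_singleton, smul_eq_mul]
      omega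
    · intro P hP
      obtain ⟨a, m, rfl, hm⟩ := hclass P hP
      simpa using hm.ncard_class
  · exact fun x y => Subtype.ext (hcomm x y x.2 y.2)
  · exact fun x => Subtype.ext x.2
  · change Nat.card {x : S | x * x = x} = _
    rw [Nat.card_coe_set_eq, hsum, ← Finset.add_sum_erase T _ hzT,
      Finset.sum_eq_card_nsmul (b := 2)]
    · have : {x | principalIdeal x = principalIdeal z ∧ x ∈ {x : S | x * x = x}} = {z} := by
        ext x
        simp only [Set.mem_ofPred_eq, hz.principalIdeal_eq_iff, Set.mem_singleton_iff]
        exact ⟨fun h => h.1, fun h => ⟨h, h ▸ (hz z).1⟩⟩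
      rw [this, Set.ncard_singleton, smul_eq_mul]
      omega
    · intro P hP
      obtain ⟨a, m, rfl, hm⟩ := hclass P hP
      exact hm.ncard_idempotents

end OfMatrixUnits

/-! ### The two implications -/

section OfCombinatorial

variable {S : Type*} [Semigroup S] [Finite S]

theorem IsB2Combinatorial.exists_zero_isMatrixUnits (h : IsB2Combinatorial S) :
    ∃ z : S, IsZeroElement z ∧ ∀ a, a ≠ z → ∃ m, IsMatrixUnits a m := by
  obtain ⟨hS, k, hk, Y, ⟨hc, hi⟩, hY⟩ := h
  have hc : ∀ x ∈ (Y : Set S), ∀ y ∈ (Y : Set S), x * y = y * x := fun x hx y hy =>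
    congrArg Subtype.val (hc ⟨x, hx⟩ ⟨y, hy⟩)
  have hi : ∀ x ∈ (Y : Set S), x * x = x := fun x hx => congrArg Subtype.val (hi ⟨x, hx⟩)
  have hY : (Y : Set S).ncard = 2 * k + 1 := by
    rw [← hY, ← Nat.card_coe_set_eq]
    rfl
  obtain ⟨z, hz, hclass⟩ := exists_zero_of_card_add_one_eq hS hc hi (by omega)
  refine ⟨z, hz, fun a ha => ?_⟩
  obtain ⟨h4, h2⟩ := hclass a ha
  obtain ⟨e, f, hef, heq⟩ := Set.ncard_eq_two.1 h2
  have he : principalIdeal e = principalIdeal a ∧ e ∈ (Y : Set S) :=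
    heq.symm.subset (Set.mem_insert e {f})
  have hf : principalIdeal f = principalIdeal a ∧ f ∈ (Y : Set S) :=
    heq.symm.subset (Set.mem_insert_of_mem e rfl)
  exact exists_isMatrixUnits (hi e he.2) (hi f hf.2) (hc e he.2 f hf.2) hef he.1 hf.1 h4

end OfCombinatorial

end SemigroupTheory

theorem theorem3 {S : Type*} [Semigroup S] [Finite S] :
    SemigroupTheory.IsB2Combinatorial S ↔
      ∃ z : S, SemigroupTheory.IsZeroElement z ∧
        ∀ a : S, a ≠ z → Nonempty (SemigroupTheory.PrincipalFactor a ≃* SemigroupTheory.B2) := by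
  constructor
  · intro h
    obtain ⟨z, hz, hm⟩ := h.exists_zero_isMatrixUnits
    exact ⟨z, hz, fun a ha => (hm a ha).elim fun m hm => hm.nonempty_mulEquiv hz ha⟩
  · rintro ⟨z, hz, h⟩
    exact SemigroupTheory.isB2Combinatorial_of_matrixUnits hz fun a ha =>
      (h a ha).elim fun Ψ => SemigroupTheory.exists_isMatrixUnits_of_mulEquiv hz ha Ψ
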